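/- Let $T=2^{<\omega}$ be the set of finite sequences with entries in $\{0,1\}$, ordered by $s\le t$ if $t$ extends $s$. A segment of $T$ is a set $\{s\in T: t\le s\le t'\}$ with $t\le t'$ in $T$. For $x:T\to\mathbb R$ put $$\|x\|_{JT}=\sup\Big(\sum_{i=1}^n\Big(\sum_{s\in S_i}x(s)\Big)^2\Big)^{1/2}\in[0,\infty],$$ where the supremum is over all finite families $S_1,\dots,S_n$ of pairwise disjoint segments of $T$. The James tree space is $JT=\{x:T\to\mathbb R:\ \|x\|_{JT}<\infty\}$ with the norm $\|\cdot\|_{JT}$. Its predual $\mathcal B$ is the closed linear span in $JT^*$ of the coordinate functionals $e_s^*:x\mapsto x(s)$, $s\in T$, with the norm of $JT^*$. A map $f:M\to N$ between metric spaces is a coarse embedding if $\omega_f(t)=\sup\{d_N(f(x),f(y)): d_M(x,y)\le t\}<\infty$ for every $t\ge 0$ and $\rho_f(t)=\inf\{d_N(f(x),f(y)): d_M(x,y)\ge t\}\to\infty$ as $t\to\infty$ (with $\sup\emptyset=0$, $\inf\emptyset=\infty$). For a Banach space $Y$, let $Y^{(0)}=Y$ and let $Y^{(r+1)}$ be the Banach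 space dual of $Y^{(r)}$. **Theorem.** Let $Y$ be a (real or complex) Banach space such that $\mathcal B$ or $JT$ coarsely embeds into $Y$. Then there exists $r\in\mathbb N$ such that $Y^{(r)}$ is not separable. -/

import Mathlib

open Filter Topology
open scoped NNReal ENNReal

noncomputable section

/-! ### Coarse embeddings -/

/-- The compression modulus `ρ_f(t) = inf {d(f x, f y) : d(x, y) ≥ t}`, with `inf ∅ = ∞`. -/
def compressionModulus {M N : Type*} [MetricSpace M] [MetricSpace N] (f : M → N) (t : ℝ≥0) :
    ℝ≥0∞ :=
  ⨅ (x : M) (y : M) (_ : (t : ℝ) ≤ dist x y), edist (f x) (f y)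

/-- The expansion modulus `ω_f(t) = sup {d(f x, f y) : d(x, y) ≤ t}`, with `sup ∅ = 0`. -/
def expansionModulus {M N : Type*} [MetricSpace M] [MetricSpace N] (f : M → N) (t : ℝ≥0) :
    ℝ≥0∞ :=
  ⨆ (x : M) (y : M) (_ : dist x y ≤ (t : ℝ)), edist (f x) (f y)

/-- `f` is a coarse embedding: `ω_f(t) < ∞` for all `t ≥ 0`, and `ρ_f(t) → ∞` as `t → ∞`. -/
def IsCoarseEmbedding {M N : Type*} [MetricSpace M] [MetricSpace N] (f : M → N) : Prop :=
  (∀ t : ℝ≥0, expansionModulus f t < ∞) ∧ Tendsto (compressionModulus f) atTop (𝓝 ∞)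

/-- `M` coarsely embeds into `N`. -/
def CoarselyEmbeds (M N : Type*) [MetricSpace M] [MetricSpace N] : Prop :=
  ∃ f : M → N, IsCoarseEmbedding f

/-! ### Iterated duals -/

/-- A normed space over `𝕜`, bundled. -/
structure BundledNormedSpace (𝕜 : Type) [RCLike 𝕜] : Type _ where
  carrier : Type*
  [group : NormedAddCommGroup carrier]
  [space : NormedSpace 𝕜 carrier]

attribute [instance] BundledNormedSpace.group BundledNormedSpace.space

/-- `Y^{(r)}`, with `Y^{(0)} = Y` and `Y^{(r+1)}` the topological dual of `Y^{(r)}` with the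
operator norm, as a bundled normed space. -/
def bundledIteratedDual (𝕜 : Type) [RCLike 𝕜] (Y : Type*) [NormedAddCommGroup Y]
    [NormedSpace 𝕜 Y] : ℕ → BundledNormedSpace 𝕜
  | 0 => ⟨Y⟩
  | r + 1 => ⟨StrongDual 𝕜 (bundledIteratedDual 𝕜 Y r).carrier⟩

/-- The iterated dual `Y^{(r)}` of order `r`. -/
abbrev IteratedDual (𝕜 : Type) [RCLike 𝕜] (Y : Type*) [NormedAddCommGroup Y]
    [NormedSpace 𝕜 Y] (r : ℕ) : Type _ :=
  (bundledIteratedDual 𝕜 Y r).carrier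

/-! ### The James tree space -/

/-- The tree `2^{<ω}` of finite `0`-`1` sequences. Its order, "`t` extends `s`", is the prefix
relation `s <+: t`. -/
abbrev DyadicTree : Type := List Bool

/-- The segment `{s : t ≤ s ≤ t'}`, a finite set. -/
def treeSegment (t t' : DyadicTree) : Finset DyadicTree :=
  t'.inits.toFinset.filter (fun s => t <+: s)

theorem mem_treeSegment {t t' s : DyadicTree} :
    s ∈ treeSegment t t' ↔ t <+: s ∧ s <+: t' := by
  simp [treeSegment, and_comm]

/-- `S` is a segment: `S = {s : t ≤ s ≤ t'}` for some `t ≤ t'`. -/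
def IsSegment (S : Finset DyadicTree) : Prop :=
  ∃ t t' : DyadicTree, t <+: t' ∧ S = treeSegment t t'

/-- The numbers `(∑ i, (∑ s ∈ S i, x s)²)^{1/2}`, for pairwise disjoint segments `S i`. -/
def jamesTreeSums (x : DyadicTree → ℝ) : Set ℝ :=
  {a | ∃ (n : ℕ) (S : Fin n → Finset DyadicTree), (∀ i, IsSegment (S i)) ∧
    Pairwise (fun i j => Disjoint (S i) (S j)) ∧ a = √(∑ i, (∑ s ∈ S i, x s) ^ 2)}

theorem zero_mem_jamesTreeSums (x : DyadicTree → ℝ) : 0 ∈ jamesTreeSums x :=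
  ⟨0, fun i => i.elim0, fun i => i.elim0, fun i => i.elim0, by simp⟩

theorem abs_mem_jamesTreeSums (x : DyadicTree → ℝ) (s : DyadicTree) :
    |x s| ∈ jamesTreeSums x := by
  have h : treeSegment s s = {s} := by
    ext u
    rw [mem_treeSegment, Finset.mem_singleton]
    constructor
    · rintro ⟨h1, h2⟩
      exact h2.eq_of_length (le_antisymm h2.length_le h1.length_le)
    · rintro rfl
      exact ⟨List.prefix_rfl, List.prefix_rfl⟩
  refine ⟨1, fun _ => {s}, fun _ => ⟨s, s, List.prefix_rfl, h.symm⟩,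
    fun i j hij => absurd (Subsingleton.elim i j) hij, ?_⟩
  simp [Real.sqrt_sq_eq_abs]

/-- The James tree norm of `x : 2^{<ω} → ℝ` (meaningful where the supremum is finite). -/
def jamesTreeNorm (x : DyadicTree → ℝ) : ℝ := sSup (jamesTreeSums x)

theorem jamesTreeSums_add {x y : DyadicTree → ℝ} (hx : BddAbove (jamesTreeSums x))
    (hy : BddAbove (jamesTreeSums y)) {a : ℝ} (ha : a ∈ jamesTreeSums (x + y)) :
    a ≤ jamesTreeNorm x + jamesTreeNorm y := by
  obtain ⟨n, S, hS, hd, rfl⟩ := ha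
  have h1 := le_csSup hx ⟨n, S, hS, hd, rfl⟩
  have h2 := le_csSup hy ⟨n, S, hS, hd, rfl⟩
  refine le_trans ?_ (add_le_add h1 h2)
  have h := norm_add_le (WithLp.toLp 2 (fun i => ∑ s ∈ S i, x s) : EuclideanSpace ℝ (Fin n))
    (WithLp.toLp 2 (fun i => ∑ s ∈ S i, y s))
  simpa [EuclideanSpace.norm_eq, Finset.sum_add_distrib] using h

theorem jamesTreeSums_smul {x : DyadicTree → ℝ} (c : ℝ) (hx : BddAbove (jamesTreeSums x))
    {a : ℝ} (ha : a ∈ jamesTreeSums (c • x)) : a ≤ |c| * jamesTreeNorm x := by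
  obtain ⟨n, S, hS, hd, rfl⟩ := ha
  have h1 := le_csSup hx ⟨n, S, hS, hd, rfl⟩
  refine le_trans (le_of_eq ?_) (mul_le_mul_of_nonneg_left h1 (abs_nonneg c))
  simp only [Pi.smul_apply, smul_eq_mul, ← Finset.mul_sum, mul_pow]
  rw [Real.sqrt_mul (sq_nonneg c), Real.sqrt_sq_eq_abs]

/-- The functions `x : 2^{<ω} → ℝ` of finite James tree norm. -/
def jamesTreeSubmodule : Submodule ℝ (DyadicTree → ℝ) where
  carrier := {x | BddAbove (jamesTreeSums x)}
  add_mem' hx hy := ⟨_, fun _ ha => jamesTreeSums_add hx hy ha⟩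
  zero_mem' := ⟨0, by rintro a ⟨n, S, -, -, rfl⟩; simp⟩
  smul_mem' c _ hx := ⟨_, fun _ ha => jamesTreeSums_smul c hx ha⟩

/-- The James tree space `JT = {x : 2^{<ω} → ℝ : ‖x‖ < ∞}`. A separate type, so that it does not
carry the topology of pointwise convergence. -/
def JamesTree : Type := ↥jamesTreeSubmodule

namespace JamesTree

instance instAddCommGroup : AddCommGroup JamesTree :=
  inferInstanceAs (AddCommGroup ↥jamesTreeSubmodule)

instance instModule : Module ℝ JamesTree :=
  inferInstanceAs (Module ℝ ↥jamesTreeSubmodule)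

/-- The underlying function on the tree, as a linear map. -/
def toFun : JamesTree →ₗ[ℝ] (DyadicTree → ℝ) := jamesTreeSubmodule.subtype

theorem toFun_injective : Function.Injective toFun := Subtype.val_injective

theorem bddAbove (x : JamesTree) : BddAbove (jamesTreeSums (toFun x)) := Subtype.property x

instance instNorm : Norm JamesTree := ⟨fun x => jamesTreeNorm (toFun x)⟩

theorem norm_def (x : JamesTree) : ‖x‖ = jamesTreeNorm (toFun x) := rfl

theorem abs_apply_le (x : JamesTree) (s : DyadicTree) : |toFun x s| ≤ ‖x‖ :=
  le_csSup x.bddAbove (abs_mem_jamesTreeSums _ s)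

theorem norm_smul_le' (c : ℝ) (x : JamesTree) : ‖c • x‖ ≤ |c| * ‖x‖ := by
  rw [norm_def, map_smul]
  exact csSup_le ⟨0, zero_mem_jamesTreeSums _⟩ fun a ha => jamesTreeSums_smul c x.bddAbove ha

theorem normedSpaceCore : NormedSpace.Core ℝ JamesTree where
  norm_nonneg x := le_csSup x.bddAbove (zero_mem_jamesTreeSums _)
  norm_smul c x := by
    rw [Real.norm_eq_abs]
    refine le_antisymm (norm_smul_le' c x) ?_
    rcases eq_or_ne c 0 with rfl | hc
    · rw [abs_zero, zero_mul]
      exact le_csSup (bddAbove _) (zero_mem_jamesTreeSums _)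
    · have h := norm_smul_le' c⁻¹ (c • x)
      rw [inv_smul_smul₀ hc, abs_inv] at h
      have := mul_le_mul_of_nonneg_left h (abs_nonneg c)
      rwa [mul_inv_cancel_left₀ (abs_ne_zero.mpr hc)] at this
  norm_triangle x y := by
    rw [norm_def, map_add]
    exact csSup_le ⟨0, zero_mem_jamesTreeSums _⟩
      fun a ha => jamesTreeSums_add x.bddAbove y.bddAbove ha
  norm_eq_zero_iff x := by
    constructor
    · intro h
      apply toFun_injective
      ext s
      have := abs_apply_le x s
      rw [h] at this
      simpa using abs_nonpos_iff.mp this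
    · rintro rfl
      refine le_antisymm ?_ (le_csSup (bddAbove _) (zero_mem_jamesTreeSums _))
      simpa using norm_smul_le' 0 0

instance instNormedAddCommGroup : NormedAddCommGroup JamesTree :=
  NormedAddCommGroup.ofCore normedSpaceCore

instance instNormedSpace : NormedSpace ℝ JamesTree :=
  NormedSpace.ofCore normedSpaceCore

/-- The coordinate functional `e*_s : x ↦ x s` on `JT`. -/
def coordFunctional (s : DyadicTree) : StrongDual ℝ JamesTree :=
  LinearMap.mkContinuous ((LinearMap.proj s).comp toFun) 1
    (fun x => by simpa using abs_apply_le x s)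

theorem coordFunctional_apply (s : DyadicTree) (x : JamesTree) :
    coordFunctional s x = toFun x s := rfl

end JamesTree

/-- The predual `B` of `JT`: the closed linear span in `JT*` of the coordinate functionals `e*_s`,
with the norm of `JT*`. -/
def jamesTreePredual : Submodule ℝ (StrongDual ℝ JamesTree) :=
  (Submodule.span ℝ (Set.range JamesTree.coordFunctional)).topologicalClosure

end

noncomputable section

/-! ### Iterated duals and weak* limits -/

/-! Each branch `σ` of the tree gives a sequence in the unit ball: the unit vectors at the nodes
`σ|n` in `JT`, the functionals `∑ k ≤ n, e*_{σ|k}` in the predual. Sum such a sequence over a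
`k`-tuple and divide by `√(2k)`. Interlaced tuples `m₁ < n₁ < m₂ < ⋯` then have images at distance
at most 1, whereas two distinct branches, evaluated at one tuple lying beyond their splitting level,
are at distance at least `√(k/2)`.

In `Y` these two facts conflict if `Y^{(2k)}` is separable. Compose with a coarse embedding and take
iterated weak* limits over the `k` entries: every branch yields a point of `Y^{(2k)}`. There are
uncountably many branches, so two of these points are close (`exists_ne_iterate_re_lt`). Small
variation on interlaced tuples brings this closeness back to a single tuple with arbitrarily large
entries (`exists_ne_norm_sub_lt`), at a distance bounded independently of `k`. For large `k` this
contradicts the lower modulus of the embedding (`exists_not_separable_of_coarselyEmbeds`). -/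

theorem bundledIteratedDual_strongDual (𝕜 : Type) [RCLike 𝕜] (Y : Type*) [NormedAddCommGroup Y]
    [NormedSpace 𝕜 Y] (r : ℕ) :
    bundledIteratedDual 𝕜 (StrongDual 𝕜 Y) r = bundledIteratedDual 𝕜 Y (r + 1) := by
  induction r with
  | zero => rfl
  | succ r ih =>
    rw [bundledIteratedDual, ih]
    rfl

/-- A bounded sequence has a weak* limit in the bidual along every ultrafilter. -/
theorem exists_bidual_limit {𝕜 : Type} [RCLike 𝕜] {Z : Type*} [NormedAddCommGroup Z]
    [NormedSpace 𝕜 Z] (U : Ultrafilter ℕ) (u : ℕ → Z) (B : ℝ) (hu : ∀ n, ‖u n‖ ≤ B) :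
    ∃ z : StrongDual 𝕜 (StrongDual 𝕜 Z), ‖z‖ ≤ B ∧
      ∀ φ : StrongDual 𝕜 Z, Tendsto (fun n => φ (u n)) U (𝓝 (z φ)) := by
  let v : ℕ → WeakDual 𝕜 (StrongDual 𝕜 Z) :=
    fun n => StrongDual.toWeakDual (NormedSpace.inclusionInDoubleDual 𝕜 Z (u n))
  have hc := WeakDual.isCompact_closedBall (𝕜 := 𝕜) (E := StrongDual 𝕜 Z) 0 B
  obtain ⟨z, hz, hle⟩ := hc.ultrafilter_le_nhds (U.map v) (by
    rw [le_principal_iff]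
    refine Filter.mem_map.2 (Filter.univ_mem' fun n => ?_)
    have h1 := NormedSpace.double_dual_bound 𝕜 Z (u n)
    have : ‖NormedSpace.inclusionInDoubleDual 𝕜 Z (u n)‖ ≤ B := h1.trans (hu n)
    simpa [v] using this)
  refine ⟨WeakDual.toStrongDual z, by simpa using hz, fun φ => ?_⟩
  have ht : Tendsto v U (𝓝 z) := hle
  have := ((WeakDual.eval_continuous φ).tendsto z).comp ht
  exact this

/-! ### Iterated quantifiers along an ultrafilter -/

/-- `P` holds for almost all extensions of the two (reversed) tuples by one entry each. -/
def AlmostAllCons (U : Ultrafilter ℕ) (P : List ℕ → List ℕ → Prop) : List ℕ → List ℕ → Prop :=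
  fun a b => ∀ᶠ m in (U : Filter ℕ), ∀ᶠ n in (U : Filter ℕ), P (m :: a) (n :: b)

theorem AlmostAllCons.mono {U : Ultrafilter ℕ} {P Q : List ℕ → List ℕ → Prop}
    (h : ∀ a b, P a b → Q a b) {a b : List ℕ} (hP : AlmostAllCons U P a b) :
    AlmostAllCons U Q a b :=
  Eventually.mono hP fun _ hm => hm.mono fun _ => h _ _

theorem AlmostAllCons.iterate_mono {U : Ultrafilter ℕ} (k : ℕ) {P Q : List ℕ → List ℕ → Prop}
    (h : ∀ a b, P a b → Q a b) {a b : List ℕ} (hP : (AlmostAllCons U)^[k] P a b) :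
    (AlmostAllCons U)^[k] Q a b := by
  induction k generalizing P Q with
  | zero => exact h _ _ hP
  | succ k ih =>
    rw [Function.iterate_succ_apply] at hP ⊢
    exact ih (fun _ _ => AlmostAllCons.mono h) hP

/-- The tuples `m₁ < n₁ < m₂ < n₂ < ⋯` with entries at least `N`, listed in decreasing order. -/
inductive Interlaced (N : ℕ) : List ℕ → List ℕ → Prop
  | nil : Interlaced N [] []
  | cons {a b : List ℕ} {m n : ℕ} (h : Interlaced N a b) (hN : N ≤ m) (hb : ∀ x ∈ b, x < m)
      (hmn : m < n) : Interlaced N (m :: a) (n :: b)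

namespace Interlaced

variable {N : ℕ} {a b : List ℕ}

theorem length_eq (h : Interlaced N a b) : a.length = b.length := by
  induction h with
  | nil => rfl
  | cons _ _ _ _ ih => simp [ih]

theorem le_of_mem_left (h : Interlaced N a b) : ∀ x ∈ a, N ≤ x := by
  induction h with
  | nil => simp
  | cons _ hN _ _ ih => simpa using ⟨hN, ih⟩

theorem exists_right_of_left (h : Interlaced N a b) : ∀ x ∈ a, ∃ y ∈ b, x < y := by
  induction h with
  | nil => simp
  | @cons a b m n _ hN _ hmn ih =>
    intro x hx
    rcases List.mem_cons.1 hx with rfl | hx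
    · exact ⟨n, by simp, hmn⟩
    · obtain ⟨y, hy, hxy⟩ := ih x hx
      exact ⟨y, by simp [hy], hxy⟩

theorem left_lt (h : Interlaced N a b) {m : ℕ} (hb : ∀ x ∈ b, x < m) : ∀ x ∈ a, x < m :=
  fun x hx => by
    obtain ⟨y, hy, hxy⟩ := h.exists_right_of_left x hx
    exact hxy.trans (hb y hy)

end Interlaced

/-- Iterated quantification along a nonprincipal ultrafilter meets the interlaced tuples. -/
theorem exists_interlaced {U : Ultrafilter ℕ} (hU : (U : Filter ℕ) ≤ atTop) (N k : ℕ)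
    {P : List ℕ → List ℕ → Prop} {a b : List ℕ} (hab : Interlaced N a b)
    (hP : (AlmostAllCons U)^[k] P a b) :
    ∃ a' b', Interlaced N a' b' ∧ a'.length = a.length + k ∧ P a' b' := by
  induction k generalizing a b with
  | zero => exact ⟨a, b, hab, rfl, hP⟩
  | succ k ih =>
    rw [Function.iterate_succ_apply'] at hP
    -- The sum of `b` serves as an upper bound for all its entries.
    have h1 : ∀ᶠ m in (U : Filter ℕ), N ≤ m ∧ b.sum < m :=
      hU ((eventually_ge_atTop N).and (eventually_gt_atTop _))
    obtain ⟨m, hm, hNm, hbm⟩ := (Eventually.and hP h1).exists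
    obtain ⟨n, hn, hmn⟩ := (hm.and (hU (eventually_gt_atTop m))).exists
    obtain ⟨a', b', h, hl, hP'⟩ := ih
      (hab.cons hNm (fun x hx => (List.le_sum_of_mem hx).trans_lt hbm) hmn) hn
    exact ⟨a', b', h, by simp at hl; omega, hP'⟩

/-! ### Uncountable families of maps on tuples -/

theorem exists_ne_dist_lt {Y ι : Type*} [MetricSpace Y] [TopologicalSpace.SeparableSpace Y]
    [Uncountable ι] (f : ι → Y) {ε : ℝ} (hε : 0 < ε) : ∃ i j, i ≠ j ∧ dist (f i) (f j) < ε := by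
  by_contra! H
  have : (Set.univ : Set ι).Countable := by
    refine Set.PairwiseDisjoint.countable_of_isOpen (s := fun i => Metric.ball (f i) (ε / 2))
      (fun i _ j _ hij => Metric.ball_disjoint_ball (by linarith [H i j hij]))
      (fun _ _ => Metric.isOpen_ball) (fun i _ => ⟨f i, Metric.mem_ball_self (by linarith)⟩)
  exact Set.not_countable_univ this

/-- Induction on `k`, removing the last entry of the tuples. The weak* limits `F` of the maps and
`G` of the functionals over that entry lie in `Y**` and `Y***`, and `G a (F i b - F j b)` is the
limit over `m`, then over `n`, of `g (m :: a) (f i (n :: b) - f j (n :: b))`. This order of limits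
is why the entries of `a` and `b` alternate. The pair `i, j` is fixed before `g`, so `g` may later
depend on it. -/
theorem exists_ne_iterate_re_lt {𝕜 : Type} [RCLike 𝕜] {ι : Type*} [Uncountable ι]
    (U : Ultrafilter ℕ) (k : ℕ) {ε : ℝ} (hε : 0 < ε) (Y : Type*) [NormedAddCommGroup Y]
    [NormedSpace 𝕜 Y] (hY : TopologicalSpace.SeparableSpace (IteratedDual 𝕜 Y (2 * k)))
    (f : ι → List ℕ → Y) (hf : ∀ i, ∃ B, ∀ l, ‖f i l‖ ≤ B) :
    ∃ i j, i ≠ j ∧ ∀ g : List ℕ → StrongDual 𝕜 Y, (∀ l, ‖g l‖ ≤ 1) →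
      (AlmostAllCons U)^[k] (fun a b => RCLike.re (g a (f i b - f j b)) < ε) [] [] := by
  induction k generalizing Y with
  | zero =>
    have : TopologicalSpace.SeparableSpace Y := hY
    obtain ⟨i, j, hij, h⟩ := exists_ne_dist_lt (fun i => f i []) hε
    refine ⟨i, j, hij, fun g hg => ?_⟩
    rw [dist_eq_norm] at h
    calc RCLike.re (g [] (f i [] - f j [])) ≤ ‖g [] (f i [] - f j [])‖ := RCLike.re_le_norm _
      _ ≤ 1 * ‖f i [] - f j []‖ := (g []).le_of_opNorm_le (hg _) _
      _ < ε := by rwa [one_mul]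
  | succ k ih =>
    -- The induction hypothesis is applied to `Y**`, whose dual of order `2k` is the dual of `Y` of
    -- order `2(k + 1)`.
    have hY' : TopologicalSpace.SeparableSpace
        (IteratedDual 𝕜 (StrongDual 𝕜 (StrongDual 𝕜 Y)) (2 * k)) := by
      unfold IteratedDual
      rw [bundledIteratedDual_strongDual, bundledIteratedDual_strongDual]
      exact hY
    choose B hB using hf
    choose F hFB hF using fun i l => exists_bidual_limit (𝕜 := 𝕜) U (fun n => f i (n :: l)) (B i)
      (fun n => hB i _)
    obtain ⟨i, j, hij, h⟩ := ih _ hY' F (fun i => ⟨B i, hFB i⟩)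
    refine ⟨i, j, hij, fun g hg => ?_⟩
    choose G hGB hG using fun l => exists_bidual_limit (𝕜 := 𝕜) U (fun n => g (n :: l)) 1
      (fun n => hg _)
    rw [Function.iterate_succ_apply]
    refine AlmostAllCons.iterate_mono k (fun a b hab => ?_) (h G hGB)
    have h1 := (RCLike.continuous_re.tendsto _).comp (hG a (F i b - F j b))
    filter_upwards [h1.eventually_lt_const hab] with m hm
    have h2 := (RCLike.continuous_re.tendsto _).comp
      ((hF i b (g (m :: a))).sub (hF j b (g (m :: a))))
    refine (h2.eventually_lt_const hm).mono fun n hn => ?_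
    rw [map_sub]
    exact hn

/-- If the even iterated dual of order `2k` is separable, then two members of an uncountable family
of bounded maps on `k`-tuples are close to each other at some tuple, as soon as they vary little
between interlaced tuples. -/
theorem exists_ne_norm_sub_lt (𝕜 : Type) [RCLike 𝕜] {ι : Type*} [Uncountable ι] (k : ℕ) {ε : ℝ}
    (hε : 0 < ε) (Y : Type*) [NormedAddCommGroup Y] [NormedSpace 𝕜 Y]
    (hY : TopologicalSpace.SeparableSpace (IteratedDual 𝕜 Y (2 * k)))
    (f : ι → List ℕ → Y) (hf : ∀ i, ∃ B, ∀ l, ‖f i l‖ ≤ B) {C : ℝ}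
    (hC : ∀ i a b, Interlaced 0 a b → a.length = k → ‖f i b - f i a‖ ≤ C) :
    ∃ i j, i ≠ j ∧ ∀ N, ∃ a b, Interlaced N a b ∧ a.length = k ∧
      ‖f i a - f j a‖ < 2 * C + ε := by
  obtain ⟨i, j, hij, h⟩ := exists_ne_iterate_re_lt (hyperfilter ℕ) k hε Y hY f hf
  refine ⟨i, j, hij, fun N => ?_⟩
  -- `g a` norms the difference at `a`, but is shown to be small on the difference at the interlaced
  -- tuple `b`; passing from `b` to `a` costs at most `C` for each of `i` and `j`.
  choose g hg1 hg using fun l => exists_dual_vector'' 𝕜 (f i l - f j l)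
  obtain ⟨a, b, hab, hl, hP⟩ := exists_interlaced (N := N)
    (Nat.hyperfilter_le_atTop) k Interlaced.nil (h g hg1)
  have hl' : a.length = k := by simpa using hl
  refine ⟨a, b, hab, hl', ?_⟩
  have hab0 : Interlaced 0 a b := by
    clear hP hl hl'
    induction hab with
    | nil => exact .nil
    | cons _ _ hb hmn ih => exact ih.cons (Nat.zero_le _) hb hmn
  have h1 : ‖f i a - f j a‖ = RCLike.re (g a (f i a - f j a)) := by
    rw [hg a, RCLike.ofReal_re]
  have h2 : g a (f i a - f j a) =
      g a (f i b - f j b) - g a ((f i b - f i a) - (f j b - f j a)) := by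
    rw [← map_sub]
    congr 1
    abel
  have h3 : -RCLike.re (g a ((f i b - f i a) - (f j b - f j a))) ≤ 2 * C := by
    calc -RCLike.re (g a ((f i b - f i a) - (f j b - f j a)))
        ≤ |RCLike.re (g a ((f i b - f i a) - (f j b - f j a)))| := neg_le_abs _
      _ ≤ ‖g a ((f i b - f i a) - (f j b - f j a))‖ := RCLike.abs_re_le_norm _
      _ ≤ 1 * ‖(f i b - f i a) - (f j b - f j a)‖ := (g a).le_of_opNorm_le (hg1 a) _
      _ ≤ 2 * C := by
        rw [one_mul]
        refine (norm_sub_le _ _).trans ?_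
        linarith [hC i a b hab0 hl', hC j a b hab0 hl']
  rw [h1, h2, map_sub]
  linarith

/-! ### Coarse embeddings -/

theorem CoarselyEmbeds.exists_bounds {M N : Type*} [MetricSpace M] [MetricSpace N]
    (h : CoarselyEmbeds M N) : ∃ F : M → N,
      (∀ t : ℝ, ∃ C : ℝ, ∀ x y, dist x y ≤ t → dist (F x) (F y) ≤ C) ∧
      ∀ C : ℝ, ∃ t : ℝ, ∀ x y, t ≤ dist x y → C < dist (F x) (F y) := by
  obtain ⟨F, hω, hρ⟩ := h
  refine ⟨F, fun t => ?_, fun C => ?_⟩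
  · refine ⟨(expansionModulus F t.toNNReal).toReal, fun x y hxy => ?_⟩
    rw [dist_edist]
    refine ENNReal.toReal_mono (hω _).ne ?_
    exact le_iSup_of_le x (le_iSup_of_le y (le_iSup_of_le (hxy.trans (Real.le_coe_toNNReal t))
      le_rfl))
  · obtain ⟨t, ht⟩ := (hρ.eventually_const_lt (ENNReal.ofReal_lt_top (r := C))).exists
    refine ⟨t, fun x y hxy => ?_⟩
    have h1 : compressionModulus F t ≤ edist (F x) (F y) :=
      iInf_le_of_le x (iInf_le_of_le y (iInf_le_of_le hxy le_rfl))
    have h2 := ht.trans_le h1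
    rw [edist_dist] at h2
    exact (ENNReal.ofReal_lt_ofReal_iff'.1 h2).1

/-- A criterion for a space not to embed coarsely into a space with separable iterated duals. -/
theorem exists_not_separable_of_coarselyEmbeds (𝕜 : Type) [RCLike 𝕜] {X ι : Type*}
    [NormedAddCommGroup X] [NormedSpace ℝ X] [Uncountable ι] (p : ι → ℕ → X)
    (hp : ∀ i n, ‖p i n‖ ≤ 1)
    (hup : ∀ i a b, Interlaced 0 a b →
      ‖(b.map (p i)).sum - (a.map (p i)).sum‖ ≤ √(2 * a.length))
    (hlow : ∀ i j, i ≠ j → ∃ N, ∀ a b, Interlaced N a b →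
      (a.length : ℝ) ≤ ‖(a.map (p i)).sum - (a.map (p j)).sum‖)
    (Y : Type*) [NormedAddCommGroup Y] [NormedSpace 𝕜 Y] (hXY : CoarselyEmbeds X Y) :
    ∃ r : ℕ, ¬ TopologicalSpace.SeparableSpace (IteratedDual 𝕜 Y r) := by
  by_contra! hsep
  obtain ⟨F, hω, hρ⟩ := hXY.exists_bounds
  obtain ⟨C, hC⟩ := hω 1
  obtain ⟨t, ht⟩ := hρ (2 * C + 1)
  -- This makes `k / √(2k) = √(k/2)`, the separation of two branches, at least `t`.
  obtain ⟨k, hk⟩ := exists_nat_gt (2 * t ^ 2)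
  have hk0 : (0 : ℝ) < k := lt_of_le_of_lt (by positivity) hk
  have hs0 : 0 < √(2 * k) := by positivity
  -- Truncation to `k` entries keeps `φ i`, hence `F ∘ φ i`, bounded on lists of every length, as
  -- the weak* limits require.
  let φ : ι → List ℕ → X := fun i l => (√(2 * k))⁻¹ • ((l.take k).map (p i)).sum
  have hsum : ∀ i (l : List ℕ), ‖(l.map (p i)).sum‖ ≤ l.length := by
    intro i l
    induction l with
    | nil => simp
    | cons n l ih =>
      rw [List.map_cons, List.sum_cons, List.length_cons, Nat.cast_succ, add_comm]
      exact (norm_add_le _ _).trans (by linarith [hp i n])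
  have hφ : ∀ i l, ‖φ i l‖ ≤ (√(2 * k))⁻¹ * k := by
    intro i l
    rw [norm_smul, norm_inv, Real.norm_of_nonneg hs0.le]
    gcongr
    refine (hsum i _).trans ?_
    exact_mod_cast List.length_take_le k l
  obtain ⟨D, hD⟩ := hω ((√(2 * k))⁻¹ * k)
  obtain ⟨i, j, hij, h⟩ := exists_ne_norm_sub_lt 𝕜 k one_pos Y (hsep _)
    (fun i l => F (φ i l)) (C := C) (fun i => ⟨D + ‖F 0‖, fun l => by
      have h1 := hD (φ i l) 0 (by simpa using hφ i l)
      rw [dist_eq_norm] at h1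
      have h2 := norm_le_norm_sub_add (F (φ i l)) (F 0)
      linarith⟩)
    (fun i a b hab hl => by
      rw [← dist_eq_norm]
      apply hC
      have hl2 : b.length = k := hab.length_eq ▸ hl
      rw [dist_eq_norm, ← smul_sub, norm_smul, norm_inv, Real.norm_of_nonneg hs0.le,
        List.take_of_length_le hl.le, List.take_of_length_le hl2.le, inv_mul_le_iff₀ hs0, mul_one]
      simpa [hl] using hup i a b hab)
  obtain ⟨N, hN⟩ := hlow i j hij
  obtain ⟨a, b, hab, hl, hlt⟩ := h N
  refine (ht (φ i a) (φ j a) ?_).not_gt (by rwa [dist_eq_norm])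
  have h1 := hN a b hab
  rw [hl] at h1
  rw [dist_eq_norm, ← smul_sub, norm_smul, norm_inv, Real.norm_of_nonneg hs0.le,
    List.take_of_length_le hl.le, le_inv_mul_iff₀ hs0]
  refine le_trans ?_ h1
  refine le_of_abs_le (abs_le_of_sq_le_sq ?_ hk0.le)
  rw [mul_pow, Real.sq_sqrt (by positivity)]
  nlinarith

/-! ### Branches -/

/-- The initial segment of length `n` of the branch `σ`. -/
def branchNode (σ : ℕ → Bool) (n : ℕ) : DyadicTree := (List.range n).map σ

@[simp] theorem length_branchNode (σ : ℕ → Bool) (n : ℕ) : (branchNode σ n).length = n := by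
  simp [branchNode]

theorem branchNode_prefix (σ : ℕ → Bool) {m n : ℕ} (h : m ≤ n) :
    branchNode σ m <+: branchNode σ n := by
  obtain ⟨k, rfl⟩ := Nat.exists_eq_add_of_le h
  exact ⟨_, by rw [branchNode, branchNode, List.range_add, List.map_append]⟩

theorem branchNode_injective (σ : ℕ → Bool) : Function.Injective (branchNode σ) :=
  fun m n h => by simpa using congrArg List.length h

theorem eq_branchNode_of_prefix {σ : ℕ → Bool} {n : ℕ} {s : DyadicTree}
    (h : s <+: branchNode σ n) : s = branchNode σ s.length := by
  have hl : s.length ≤ n := by simpa using h.length_le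
  exact (List.prefix_of_prefix_length_le h (branchNode_prefix σ hl) (by simp)).eq_of_length
    (by simp)

theorem exists_branchNode_not_prefix {σ τ : ℕ → Bool} (h : σ ≠ τ) :
    ∃ N, ∀ n, ¬ branchNode σ N <+: branchNode τ n := by
  obtain ⟨k, hk⟩ := Function.ne_iff.1 h
  -- The node of length `k + 1` is the first to contain the entry of index `k`.
  refine ⟨k + 1, fun n hn => hk ?_⟩
  have h1 := eq_branchNode_of_prefix hn
  rw [length_branchNode] at h1
  have h2 := congrArg (fun l => l[k]?) h1
  simpa [branchNode] using h2

theorem mem_treeSegment_branchNode {σ : ℕ → Bool} {m n : ℕ} {s : DyadicTree} :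
    s ∈ treeSegment (branchNode σ m) (branchNode σ n) ↔
      ∃ k, m ≤ k ∧ k ≤ n ∧ s = branchNode σ k := by
  rw [mem_treeSegment]
  constructor
  · rintro ⟨h1, h2⟩
    exact ⟨s.length, by simpa using h1.length_le, by simpa using h2.length_le,
      eq_branchNode_of_prefix h2⟩
  · rintro ⟨k, h1, h2, rfl⟩
    exact ⟨branchNode_prefix σ h1, branchNode_prefix σ h2⟩

theorem treeSegment_branchNode (σ : ℕ → Bool) (m n : ℕ) :
    treeSegment (branchNode σ m) (branchNode σ n) = (Finset.Icc m n).image (branchNode σ) := by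
  ext s
  rw [mem_treeSegment_branchNode]
  simp [and_assoc, eq_comm]

/-! ### Unit vectors of the James tree space -/

namespace JamesTree

theorem sum_sq_le (x : JamesTree) {n : ℕ} (S : Fin n → Finset DyadicTree)
    (hS : ∀ i, IsSegment (S i)) (hd : Pairwise (fun i j => Disjoint (S i) (S j))) :
    √(∑ i, (∑ s ∈ S i, toFun x s) ^ 2) ≤ ‖x‖ :=
  le_csSup x.bddAbove ⟨n, S, hS, hd, rfl⟩

theorem abs_sum_segment_le (x : JamesTree) {S : Finset DyadicTree} (hS : IsSegment S) :
    |∑ s ∈ S, toFun x s| ≤ ‖x‖ := by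
  have h := sum_sq_le x (n := 1) (fun _ => S) (fun _ => hS)
    (fun i j hij => absurd (Subsingleton.elim i j) hij)
  simpa [Real.sqrt_sq_eq_abs] using h

theorem norm_le {x : JamesTree} {C : ℝ} (h : ∀ a ∈ jamesTreeSums (toFun x), a ≤ C) : ‖x‖ ≤ C :=
  csSup_le ⟨0, zero_mem_jamesTreeSums _⟩ h

end JamesTree

theorem sum_indicator_le_one {n : ℕ} (S : Fin n → Finset DyadicTree)
    (hd : Pairwise (fun i j => Disjoint (S i) (S j))) (s : DyadicTree) :
    ∑ i, (if s ∈ S i then (1 : ℝ) else 0) ≤ 1 := by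
  by_cases h : ∃ i, s ∈ S i
  · obtain ⟨i, hi⟩ := h
    rw [Finset.sum_eq_single i]
    · simp [hi]
    · intro j _ hj
      rw [if_neg]
      exact fun hsj => (Finset.disjoint_left.1 (hd hj) hsj) hi
    · simp
  · push Not at h
    simp [h]

theorem sqrt_sum_sq_single_le {n : ℕ} (S : Fin n → Finset DyadicTree)
    (hd : Pairwise (fun i j => Disjoint (S i) (S j))) (s : DyadicTree) :
    √(∑ i, (∑ t ∈ S i, (Pi.single s 1 : DyadicTree → ℝ) t) ^ 2) ≤ 1 := by
  rw [Real.sqrt_le_one]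
  refine le_trans (le_of_eq ?_) (sum_indicator_le_one S hd s)
  refine Finset.sum_congr rfl fun i _ => ?_
  simp only [Finset.sum_pi_single']
  split_ifs <;> simp

namespace JamesTree

/-- The unit vector `e_s`. -/
def unitVector (s : DyadicTree) : JamesTree :=
  ⟨Pi.single s 1, 1, by
    rintro a ⟨n, S, -, hd, rfl⟩
    exact sqrt_sum_sq_single_le S hd s⟩

theorem toFun_unitVector (s : DyadicTree) : toFun (unitVector s) = Pi.single s 1 := rfl

theorem norm_unitVector_le (s : DyadicTree) : ‖unitVector s‖ ≤ 1 :=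
  norm_le (by
    rintro a ⟨n, S, -, hd, rfl⟩
    exact sqrt_sum_sq_single_le S hd s)

theorem sum_toFun_sum_unitVector (σ : ℕ → Bool) (S : Finset DyadicTree) (l : List ℕ) :
    ∑ s ∈ S, toFun ((l.map fun n => unitVector (branchNode σ n)).sum) s =
      (l.map fun n => if branchNode σ n ∈ S then (1 : ℝ) else 0).sum := by
  induction l with
  | nil => simp
  | cons n l ih =>
    simp only [List.map_cons, List.sum_cons, map_add, Pi.add_apply, Finset.sum_add_distrib, ih,
      toFun_unitVector]
    rw [Finset.sum_pi_single']

end JamesTree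

/-! ### Interlaced tuples -/

namespace Interlaced

variable {N : ℕ} {a b : List ℕ}

/-- If the largest entry `m` of `a` lies in `V`, so does `n > m`, and the two cancel. If not, no
smaller entry lies in `V`, and only `n` can contribute. -/
theorem sum_indicator_upperSet (h : Interlaced N a b) (V : ℕ → Prop) [DecidablePred V]
    (hV : ∀ m n, m ≤ n → V m → V n) :
    (b.map fun n => if V n then (1 : ℝ) else 0).sum - (a.map fun n => if V n then (1 : ℝ) else 0).sum
      ∈ Set.Icc (0 : ℝ) 1 := by
  induction h with
  | nil => simp
  | @cons a b m n h _ hb hmn ih =>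
    simp only [List.map_cons, List.sum_cons]
    by_cases hm : V m
    · rw [if_pos hm, if_pos (hV m n hmn.le hm), add_sub_add_left_eq_sub]
      exact ih
    · have hz : ∀ l : List ℕ, (∀ x ∈ l, x < m) →
          (l.map fun n => if V n then (1 : ℝ) else 0).sum = 0 := by
        intro l hl
        refine List.sum_eq_zero fun y hy => ?_
        obtain ⟨x, hx, rfl⟩ := List.mem_map.1 hy
        exact if_neg fun hVx => hm (hV x m (hl x hx).le hVx)
      rw [hz b hb, hz a (h.left_lt hb), if_neg hm]
      split_ifs <;> simp

/-- Along a branch, a segment is the difference of two upper sets of levels, each contributing a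
number in `[0, 1]`. -/
theorem abs_sum_indicator_segment_le (h : Interlaced N a b) (σ : ℕ → Bool)
    {S : Finset DyadicTree} (hS : IsSegment S) :
    |(b.map fun n => if branchNode σ n ∈ S then (1 : ℝ) else 0).sum -
      (a.map fun n => if branchNode σ n ∈ S then (1 : ℝ) else 0).sum| ≤ 1 := by
  classical
  obtain ⟨t, t', -, rfl⟩ := hS
  have h1 := h.sum_indicator_upperSet (fun n => t <+: branchNode σ n)
    (fun m n hmn hm => hm.trans (branchNode_prefix σ hmn))
  have h2 := h.sum_indicator_upperSet (fun n => t <+: branchNode σ n ∧ ¬ branchNode σ n <+: t')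
    (fun m n hmn hm => ⟨hm.1.trans (branchNode_prefix σ hmn),
      fun hn => hm.2 ((branchNode_prefix σ hmn).trans hn)⟩)
  have h3 : ∀ l : List ℕ,
      (l.map fun n => if branchNode σ n ∈ treeSegment t t' then (1 : ℝ) else 0).sum =
      (l.map fun n => if t <+: branchNode σ n then (1 : ℝ) else 0).sum -
      (l.map fun n => if t <+: branchNode σ n ∧ ¬ branchNode σ n <+: t' then (1 : ℝ) else 0).sum := by
    intro l
    simp only [mem_treeSegment]
    induction l with
    | nil => simp
    | cons n l ih =>
      simp only [List.map_cons, List.sum_cons, ih]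
      have : (if t <+: branchNode σ n ∧ branchNode σ n <+: t' then (1 : ℝ) else 0) =
          (if t <+: branchNode σ n then 1 else 0) -
          if t <+: branchNode σ n ∧ ¬ branchNode σ n <+: t' then 1 else 0 := by
        by_cases ht : t <+: branchNode σ n <;> by_cases ht' : branchNode σ n <+: t' <;>
          simp [ht, ht']
      rw [this]
      ring
  rw [h3, h3, abs_le]
  constructor <;> linarith [h1.1, h1.2, h2.1, h2.2]

/-- On each segment the counts of `a` and `b` differ by at most 1, so the squared difference is at
most the sum of the counts. Over disjoint segments these sums total at most `2 * a.length`. -/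
theorem norm_sum_unitVector_sub_le (h : Interlaced N a b) (σ : ℕ → Bool) :
    ‖(b.map fun n => JamesTree.unitVector (branchNode σ n)).sum -
      (a.map fun n => JamesTree.unitVector (branchNode σ n)).sum‖ ≤ √(2 * a.length) := by
  refine JamesTree.norm_le ?_
  rintro _ ⟨n, S, hS, hd, rfl⟩
  apply Real.sqrt_le_sqrt
  let c (l : List ℕ) (i : Fin n) : ℝ :=
    (l.map fun n => if branchNode σ n ∈ S i then (1 : ℝ) else 0).sum
  have hc0 : ∀ l i, 0 ≤ c l i := fun l i => List.sum_nonneg fun y hy => by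
    obtain ⟨x, -, rfl⟩ := List.mem_map.1 hy
    positivity
  have hc : ∀ l, ∑ i, c l i ≤ l.length := by
    intro l
    induction l with
    | nil => simp [c]
    | cons m l ih =>
      simp only [c, List.map_cons, List.sum_cons, Finset.sum_add_distrib, List.length_cons,
        Nat.cast_succ] at ih ⊢
      linarith [sum_indicator_le_one S hd (branchNode σ m)]
  have key : ∀ i, (∑ s ∈ S i, JamesTree.toFun
      ((b.map fun n => JamesTree.unitVector (branchNode σ n)).sum -
      (a.map fun n => JamesTree.unitVector (branchNode σ n)).sum) s) ^ 2 ≤ c b i + c a i := by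
    intro i
    simp only [map_sub, Pi.sub_apply, Finset.sum_sub_distrib, JamesTree.sum_toFun_sum_unitVector]
    have h1 : |c b i - c a i| ≤ 1 := h.abs_sum_indicator_segment_le σ (hS i)
    calc (c b i - c a i) ^ 2 = |c b i - c a i| * |c b i - c a i| := by rw [← sq, sq_abs]
      _ ≤ 1 * |c b i - c a i| := by gcongr
      _ ≤ c b i + c a i := by
        rw [one_mul, abs_le]
        constructor <;> linarith [hc0 a i, hc0 b i]
  calc _ ≤ ∑ i, (c b i + c a i) := Finset.sum_le_sum fun i _ => key i
    _ = ∑ i, c b i + ∑ i, c a i := Finset.sum_add_distrib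
    _ ≤ 2 * a.length := by
      have := hc a
      have := hc b
      rw [← h.length_eq] at this
      linarith

end Interlaced

/-- The test segment runs along `σ` from level `N`: it meets every `σ` term and no `τ` term. -/
theorem length_le_norm_sum_unitVector_sub {σ τ : ℕ → Bool} {N : ℕ}
    (hN : ∀ n, ¬ branchNode σ N <+: branchNode τ n) {l : List ℕ} (hl : ∀ n ∈ l, N ≤ n) :
    (l.length : ℝ) ≤ ‖(l.map fun n => JamesTree.unitVector (branchNode σ n)).sum -
      (l.map fun n => JamesTree.unitVector (branchNode τ n)).sum‖ := by
  -- Level `N + l.sum` is beyond every entry of `l`.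
  have hS : IsSegment (treeSegment (branchNode σ N) (branchNode σ (N + l.sum))) :=
    ⟨_, _, branchNode_prefix σ (by omega), rfl⟩
  refine le_trans (le_abs_self _ |>.trans' (le_of_eq ?_)) (JamesTree.abs_sum_segment_le _ hS)
  simp only [map_sub, Pi.sub_apply, Finset.sum_sub_distrib, JamesTree.sum_toFun_sum_unitVector]
  have h1 : (l.map fun n => if branchNode σ n ∈ treeSegment (branchNode σ N)
      (branchNode σ (N + l.sum)) then (1 : ℝ) else 0) = l.map fun _ => 1 :=
    List.map_congr_left fun n hn => if_pos (mem_treeSegment_branchNode.2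
      ⟨n, hl n hn, (List.le_sum_of_mem hn).trans (by omega), rfl⟩)
  have h2 : (l.map fun n => if branchNode τ n ∈ treeSegment (branchNode σ N)
      (branchNode σ (N + l.sum)) then (1 : ℝ) else 0) = l.map fun _ => 0 :=
    List.map_congr_left fun n _ => if_neg fun h => hN n (mem_treeSegment.1 h).1
  rw [h1, h2]
  simp

/-! ### Branch functionals in the predual -/

/-- The functional `x ↦ ∑ k ≤ n, x (σ|k)`. -/
def branchFunctional (σ : ℕ → Bool) (n : ℕ) : StrongDual ℝ JamesTree :=
  ∑ k ∈ Finset.range (n + 1), JamesTree.coordFunctional (branchNode σ k)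

theorem branchFunctional_apply (σ : ℕ → Bool) (n : ℕ) (x : JamesTree) :
    branchFunctional σ n x = ∑ k ∈ Finset.range (n + 1), JamesTree.toFun x (branchNode σ k) := by
  simp [branchFunctional, JamesTree.coordFunctional_apply]

theorem branchFunctional_mem (σ : ℕ → Bool) (n : ℕ) : branchFunctional σ n ∈ jamesTreePredual :=
  Submodule.le_topologicalClosure _
    (Submodule.sum_mem _ fun _ _ => Submodule.subset_span ⟨_, rfl⟩)

theorem branchFunctional_sub_apply (σ : ℕ → Bool) {m n : ℕ} (h : m ≤ n) (x : JamesTree) :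
    branchFunctional σ n x - branchFunctional σ m x =
      ∑ s ∈ treeSegment (branchNode σ (m + 1)) (branchNode σ n), JamesTree.toFun x s := by
  rw [treeSegment_branchNode, Finset.sum_image (fun _ _ _ _ h => branchNode_injective σ h),
    branchFunctional_apply, branchFunctional_apply,
    ← Finset.sum_range_add_sum_Ico _ (Nat.add_le_add_right h 1), add_sub_cancel_left]
  rfl

theorem norm_branchFunctional_le (σ : ℕ → Bool) (n : ℕ) : ‖branchFunctional σ n‖ ≤ 1 := by
  refine ContinuousLinearMap.opNorm_le_bound _ zero_le_one fun x => ?_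
  rw [one_mul, Real.norm_eq_abs]
  refine le_trans (le_of_eq ?_) (JamesTree.abs_sum_segment_le x
    (S := treeSegment (branchNode σ 0) (branchNode σ n)) ⟨_, _, branchNode_prefix σ n.zero_le, rfl⟩)
  rw [treeSegment_branchNode, Finset.sum_image (fun _ _ _ _ h => branchNode_injective σ h),
    branchFunctional_apply, Finset.range_eq_Ico]
  rfl

/-- Each pair `m < n` leaves the piece of `σ` at levels `m + 1` to `n`. The bound on node lengths by
entries of `b` serves the induction: the next segment starts above all those entries, hence is
disjoint from the earlier ones. -/
theorem Interlaced.exists_segments {N : ℕ} {a b : List ℕ} (h : Interlaced N a b) (σ : ℕ → Bool) :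
    ∃ L : List (Finset DyadicTree), L.length = a.length ∧ (∀ S ∈ L, IsSegment S) ∧
      L.Pairwise Disjoint ∧ (∀ S ∈ L, ∀ s ∈ S, ∃ x ∈ b, s.length ≤ x) ∧
      ∀ x : JamesTree, (b.map fun n => branchFunctional σ n x).sum -
        (a.map fun n => branchFunctional σ n x).sum =
        (L.map fun S => ∑ s ∈ S, JamesTree.toFun x s).sum := by
  induction h with
  | nil => exact ⟨[], by simp⟩
  | @cons a b m n h _ hb hmn ih =>
    obtain ⟨L, h1, h2, h3, h4, h5⟩ := ih
    refine ⟨treeSegment (branchNode σ (m + 1)) (branchNode σ n) :: L, by simp [h1], ?_, ?_, ?_, ?_⟩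
    · rintro S (_ | ⟨_, hS⟩)
      · exact ⟨_, _, branchNode_prefix σ hmn, rfl⟩
      · exact h2 S hS
    · refine List.pairwise_cons.2 ⟨fun S hS => Finset.disjoint_left.2 fun s hs hsS => ?_, h3⟩
      obtain ⟨x, hx, hsx⟩ := h4 S hS s hsS
      have := (mem_treeSegment.1 hs).1.length_le
      rw [length_branchNode] at this
      have := hb x hx
      omega
    · rintro S (_ | ⟨_, hS⟩) s hs
      · exact ⟨n, by simp, by simpa using (mem_treeSegment.1 hs).2.length_le⟩
      · obtain ⟨x, hx, hsx⟩ := h4 S hS s hs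
        exact ⟨x, by simp [hx], hsx⟩
    · intro x
      simp only [List.map_cons, List.sum_cons]
      rw [← h5 x, ← branchFunctional_sub_apply σ hmn.le]
      ring

/-- Cauchy–Schwarz turns the `ℓ²` sum defining the norm into an `ℓ¹` estimate. -/
theorem JamesTree.abs_sum_segments_le (x : JamesTree) {L : List (Finset DyadicTree)}
    (hS : ∀ S ∈ L, IsSegment S) (hd : L.Pairwise Disjoint) :
    |(L.map fun S => ∑ s ∈ S, toFun x s).sum| ≤ √L.length * ‖x‖ := by
  have h1 := sum_sq_le x (fun i : Fin L.length => L[i]) (fun i => hS _ (List.getElem_mem _))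
    (fun i j hij => by
      rcases lt_or_gt_of_ne hij with h | h
      · exact List.pairwise_iff_getElem.1 hd i j i.2 j.2 h
      · exact (List.pairwise_iff_getElem.1 hd j i j.2 i.2 h).symm)
  have h2 : (L.map fun S => ∑ s ∈ S, toFun x s).sum =
      ∑ i : Fin L.length, ∑ s ∈ L[i], toFun x s := by
    rw [← Fin.sum_univ_fun_getElem]
    rfl
  rw [h2]
  refine le_trans (Real.abs_le_sqrt (sq_sum_le_card_mul_sum_sq)) ?_
  rw [Real.sqrt_mul (by positivity), Finset.card_univ, Fintype.card_fin]
  gcongr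

theorem Interlaced.norm_sum_branchFunctional_sub_le {N : ℕ} {a b : List ℕ}
    (h : Interlaced N a b) (σ : ℕ → Bool) :
    ‖(b.map (branchFunctional σ)).sum - (a.map (branchFunctional σ)).sum‖ ≤ √(2 * a.length) := by
  refine ContinuousLinearMap.opNorm_le_bound _ (by positivity) fun x => ?_
  obtain ⟨L, h1, h2, h3, -, h5⟩ := h.exists_segments σ
  have happ : ∀ l : List ℕ, (l.map (branchFunctional σ)).sum x =
      (l.map fun n => branchFunctional σ n x).sum := fun l => by
    induction l with
    | nil => simp
    | cons n l ih => simp [ih]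
  rw [sub_apply, happ, happ, h5, Real.norm_eq_abs]
  refine (JamesTree.abs_sum_segments_le x h2 h3).trans ?_
  rw [h1]
  gcongr
  -- Here `√a.length` is already a bound; the factor 2 matches the estimate for `JT`, so that one
  -- criterion covers both spaces.
  linarith [(a.length.cast_nonneg : (0 : ℝ) ≤ _)]

/-- The unit vector at `σ|N` is the test vector: the functionals of `σ` from level `N` on take the
value 1 there, those of `τ` vanish. -/
theorem length_le_norm_sum_branchFunctional_sub {σ τ : ℕ → Bool} {N : ℕ}
    (hN : ∀ n, ¬ branchNode σ N <+: branchNode τ n) {l : List ℕ} (hl : ∀ n ∈ l, N ≤ n) :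
    (l.length : ℝ) ≤
      ‖(l.map (branchFunctional σ)).sum - (l.map (branchFunctional τ)).sum‖ := by
  set x := JamesTree.unitVector (branchNode σ N)
  have h1 : ∀ n, N ≤ n → branchFunctional σ n x = 1 := by
    intro n hn
    rw [branchFunctional_apply, Finset.sum_eq_single N]
    · simp [x, JamesTree.toFun_unitVector]
    · intro k _ hk
      simp [x, JamesTree.toFun_unitVector, (branchNode_injective σ).ne hk]
    · intro h
      exact absurd (Finset.mem_range.2 (by omega)) h
  have h2 : ∀ n, branchFunctional τ n x = 0 := by
    intro n
    rw [branchFunctional_apply]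
    refine Finset.sum_eq_zero fun k _ => ?_
    have : branchNode τ k ≠ branchNode σ N := fun h => hN k (h ▸ List.prefix_rfl)
    simp [x, JamesTree.toFun_unitVector, this]
  have h3 : ((l.map (branchFunctional σ)).sum - (l.map (branchFunctional τ)).sum) x = l.length := by
    induction l with
    | nil => simp
    | cons n l ih =>
      have := ih (fun k hk => hl k (by simp [hk]))
      simp only [sub_apply, List.map_cons, List.sum_cons,
        add_apply, h1 n (hl n (by simp)), h2, List.length_cons,
        Nat.cast_succ] at this ⊢
      linarith
  calc (l.length : ℝ) ≤ ‖((l.map (branchFunctional σ)).sum - (l.map (branchFunctional τ)).sum) x‖ := by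
        rw [h3]; exact le_abs_self _
    _ ≤ ‖(l.map (branchFunctional σ)).sum - (l.map (branchFunctional τ)).sum‖ * 1 :=
      ContinuousLinearMap.le_opNorm_of_le _ (JamesTree.norm_unitVector_le _)
    _ = _ := mul_one _

theorem coe_sum_branchFunctional (σ : ℕ → Bool) (l : List ℕ) :
    (((l.map fun n => (⟨branchFunctional σ n, branchFunctional_mem σ n⟩ : jamesTreePredual)).sum :
      jamesTreePredual) : StrongDual ℝ JamesTree) = (l.map (branchFunctional σ)).sum := by
  induction l with
  | nil => rfl
  | cons n l ih => simp [ih]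

end

theorem uncountable_branches : Uncountable (ℕ → Bool) := by
  rw [← Cardinal.aleph0_lt_mk_iff]
  simpa using Cardinal.cantor Cardinal.aleph0

theorem theorem6p2 {𝕜 : Type} [RCLike 𝕜] (Y : Type*) [NormedAddCommGroup Y] [NormedSpace 𝕜 Y]
    [CompleteSpace Y]
    (h : CoarselyEmbeds ↥jamesTreePredual Y ∨ CoarselyEmbeds JamesTree Y) :
    ∃ r : ℕ, ¬ TopologicalSpace.SeparableSpace (IteratedDual 𝕜 Y r) := by
  have := uncountable_branches
  rcases h with h | h
  · refine exists_not_separable_of_coarselyEmbeds 𝕜 (ι := ℕ → Bool)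
      (fun σ n => (⟨branchFunctional σ n, branchFunctional_mem σ n⟩ : jamesTreePredual))
      norm_branchFunctional_le (fun σ a b hab => ?_) (fun σ τ hστ => ?_) Y h
    · rw [← Submodule.norm_coe, Submodule.coe_sub, coe_sum_branchFunctional,
        coe_sum_branchFunctional]
      exact hab.norm_sum_branchFunctional_sub_le σ
    · obtain ⟨N, hN⟩ := exists_branchNode_not_prefix hστ
      refine ⟨N, fun a b hab => ?_⟩
      rw [← Submodule.norm_coe, Submodule.coe_sub, coe_sum_branchFunctional,
        coe_sum_branchFunctional]
      exact length_le_norm_sum_branchFunctional_sub hN hab.le_of_mem_left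
  · refine exists_not_separable_of_coarselyEmbeds 𝕜 (ι := ℕ → Bool)
      (fun σ n => JamesTree.unitVector (branchNode σ n))
      (fun _ _ => JamesTree.norm_unitVector_le _)
      (fun σ a b hab => hab.norm_sum_unitVector_sub_le σ) (fun σ τ hστ => ?_) Y h
    obtain ⟨N, hN⟩ := exists_branchNode_not_prefix hστ
    exact ⟨N, fun a b hab => length_le_norm_sum_unitVector_sub hN hab.le_of_mem_left⟩
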